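/- Let $K$ be a field, $S=K[t_1,\dots,t_s]=\bigoplus_{d\ge 0}S_d$ the polynomial ring with the standard grading, and $\mathbb X=\{[P_1],\dots,[P_m]\}$ a finite subset of the projective space $\mathbb P^{s-1}$ over $K$ with $m=|\mathbb X|$ points. For a graded ideal $I\subseteq S$ put $H_I(d)=\dim_K\big(S_d/(I\cap S_d)\big)$ and let $k=\dim(S/I)$ be the Krull dimension. The degree of $S/I$ is $\deg(S/I)=(k-1)!\,\lim_{d\to\infty}H_I(d)/d^{\,k-1}$ if $k\ge 1$, and $\deg(S/I)=\dim_K(S/I)$ if $k=0$. Put $\mathcal F_d(I)=\{f\in S_d : f\notin I,\ (I:f)\ne I\}$, and let $$\delta_I(d)=\begin{cases}\deg(S/I)-\max\{\deg(S/(I,f)) : f\in\mathcal F_d(I)\}&\text{if }\mathcal F_d(I)\ne\emptyset,\\ \deg(S/I)&\text{if }\mathcal F_d(I)=\emptyset.\end{cases}$$ Let $I(\mathbb X)\subseteq S$ be the ideal generated by the homogeneous polynomials that vanish at all points of $\mathbb X$. For $d\ge 0$ and forms $g_1,\dots,g_m\in S_d$ with $g_i(P_i)\ne 0$ for all $i$,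 let $C_{\mathbb X}(d)\subseteq K^m$ be the image of the $K$-linear map $S_d\to K^m$, $f\mapsto\big(f(P_1)/g_1(P_1),\dots,f(P_m)/g_m(P_m)\big)$, and let $\delta_{\mathbb X}(d)$ be its minimum distance, the least number of nonzero entries of a nonzero vector of $C_{\mathbb X}(d)$. **Theorem.** Suppose that $|\mathbb X|\ge 2$ and $d\ge 1$. Then, for every choice of the representatives $P_i$ and of the forms $g_i$, $$\delta_{\mathbb X}(d)=\delta_{I(\mathbb X)}(d)\ge 1 .$$ Moreover, for $I=I(\mathbb X)$ the set $\mathcal F_d(I)$ is nonempty, the degrees of $S/I$ and of $S/(I,f)$ for $f\in\mathcal F_d(I)$ exist and are non-negative integers, and the maximum in the definition of $\delta_I(d)$ is attained. -/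

import Mathlib

open Filter Topology
open scoped LinearAlgebra.Projectivization

namespace ProjCode

/-! ### Graded ideals: Hilbert function, degree, minimum distance function -/

section Ideals

variable {K : Type*} [Field K] {s : ℕ}

/-- The Hilbert function `H_I(d) = dim_K (S_d / I_d)` of `S/I`, where `S = K[t_1, …, t_s]` and
`I_d = I ∩ S_d`. -/
noncomputable def hilbertFunction (I : Ideal (MvPolynomial (Fin s) K)) (d : ℕ) : ℕ :=
  Module.finrank K
    (MvPolynomial.homogeneousSubmodule (Fin s) K d ⧸
      (I.restrictScalars K).comap (MvPolynomial.homogeneousSubmodule (Fin s) K d).subtype)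

/-- `HasDegree I e`: the degree (multiplicity) of `S/I` exists and is equal to `e`.
If `dim (S/I) = k + 1 ≥ 1`, this says that `k! H_I(d) / d ^ k` converges to `e`;
if `dim (S/I) = 0`, it says that `dim_K (S/I) = e`. (For `I = S` the degree is `0`.) -/
def HasDegree (I : Ideal (MvPolynomial (Fin s) K)) (e : ℕ) : Prop :=
  (ringKrullDim (MvPolynomial (Fin s) K ⧸ I) ≤ 0 ∧
      Module.finrank K (MvPolynomial (Fin s) K ⧸ I) = e) ∨
    ∃ k : ℕ, ringKrullDim (MvPolynomial (Fin s) K ⧸ I) = ((k + 1 : ℕ) : WithBot ℕ∞) ∧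
      Tendsto (fun d : ℕ => (k.factorial : ℝ) * ((hilbertFunction I d : ℝ) / (d : ℝ) ^ k))
        atTop (𝓝 (e : ℝ))

theorem HasDegree.unique {I : Ideal (MvPolynomial (Fin s) K)} {a b : ℕ}
    (ha : HasDegree I a) (hb : HasDegree I b) : a = b := by
  have key : ∀ k : ℕ, ¬ (((k + 1 : ℕ) : WithBot ℕ∞) ≤ 0) := by
    intro k h
    have : k + 1 ≤ 0 := by exact_mod_cast h
    omega
  rcases ha with ⟨h1, rfl⟩ | ⟨k, h1, ha⟩ <;> rcases hb with ⟨h2, rfl⟩ | ⟨l, h2, hb⟩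
  · rfl
  · exact absurd (h2 ▸ h1) (key l)
  · exact absurd (h1 ▸ h2) (key k)
  · have hkl : k = l := by
      have h3 := h1.symm.trans h2
      have : k + 1 = l + 1 := by exact_mod_cast h3
      omega
    subst hkl
    exact_mod_cast tendsto_nhds_unique ha hb

open Classical in
/-- The degree `deg (S/I)`, i.e. the unique `e` with `HasDegree I e`. By Hilbert's theorem it
exists for every graded ideal `I`; the value `0` when there is no such `e` is a junk value. -/
noncomputable def degree (I : Ideal (MvPolynomial (Fin s) K)) : ℕ :=
  if h : ∃ e, HasDegree I e then h.choose else 0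

theorem HasDegree.degree_eq {I : Ideal (MvPolynomial (Fin s) K)} {e : ℕ}
    (h : HasDegree I e) : degree I = e := by
  have h' : ∃ e, HasDegree I e := ⟨e, h⟩
  rw [degree, dif_pos h']
  exact h'.choose_spec.unique h

/-- The set `F_d` of forms `f` of degree `d` with `f ∉ I` and `(I : f) ≠ I`. -/
def zeroDivisorForms (I : Ideal (MvPolynomial (Fin s) K)) (d : ℕ) :
    Set (MvPolynomial (Fin s) K) :=
  {f | f.IsHomogeneous d ∧ f ∉ I ∧ I.colon {f} ≠ I}

/-- The numbers `deg (S/(I, f))` with `f ∈ F_d`. -/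
def zeroDivisorDegrees (I : Ideal (MvPolynomial (Fin s) K)) (d : ℕ) : Set ℕ :=
  (fun f => degree (I ⊔ Ideal.span {f})) '' zeroDivisorForms I d

open Classical in
/-- The minimum distance function `δ_I` of an ideal `I`. For a nonempty bounded set of natural
numbers `sSup` is its maximum. -/
noncomputable def minDistFunction (I : Ideal (MvPolynomial (Fin s) K)) (d : ℕ) : ℤ :=
  if (zeroDivisorForms I d).Nonempty then
    (degree I : ℤ) - (sSup (zeroDivisorDegrees I d) : ℕ)
  else (degree I : ℤ)

/-- The vanishing ideal `I(X)` of a set `X` of points of `ℙ^{s-1}`: the ideal generated by the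
homogeneous polynomials that vanish at all points of `X`. -/
noncomputable def vanishingIdeal (X : Set (ℙ K (Fin s → K))) : Ideal (MvPolynomial (Fin s) K) :=
  Ideal.span {f | (∃ n : ℕ, f.IsHomogeneous n) ∧
    ∀ (v : Fin s → K) (hv : v ≠ 0), Projectivization.mk K v hv ∈ X → MvPolynomial.eval v f = 0}

end Ideals

/-! ### Evaluation codes -/

section Codes

variable {K : Type*} [Field K] {s : ℕ} {ι : Type*}

/-- The evaluation map `ev_d : S_d → K^ι`, `f ↦ (f(P_i) / g_i(P_i))_i`. -/
noncomputable def evalMap (d : ℕ) (P : ι → Fin s → K) (g : ι → MvPolynomial (Fin s) K) :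
    MvPolynomial.homogeneousSubmodule (Fin s) K d →ₗ[K] (ι → K) where
  toFun f := fun i => MvPolynomial.eval (P i) (f : MvPolynomial (Fin s) K) /
    MvPolynomial.eval (P i) (g i)
  map_add' f h := by
    funext i
    simp [add_div]
  map_smul' c f := by
    funext i
    simp [MvPolynomial.smul_eval, mul_div_assoc]

/-- The image of the evaluation map. When the `P i` are representatives of the points of `X` and
the `g i` are forms of degree `d` with `g_i(P_i) ≠ 0`, this is the projective Reed–Muller-type
code `C_X(d)`. -/
noncomputable def reedMullerCode (d : ℕ) (P : ι → Fin s → K)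
    (g : ι → MvPolynomial (Fin s) K) : Submodule K (ι → K) :=
  LinearMap.range (evalMap d P g)

open Classical in
/-- The minimum distance of a linear code: the least number of nonzero entries of a nonzero
element of the code. -/
noncomputable def minimumDistance [Fintype ι] (C : Submodule K (ι → K)) : ℕ :=
  sInf {n | ∃ v ∈ C, v ≠ 0 ∧ hammingNorm v = n}

end Codes

end ProjCode

open ProjCode

/-! Restricted to the line through a point `P`, a form `f` of degree `n` becomes `f(P) T ^ n`, so
`I(X)` is the intersection of the kernels of these restrictions. Key fact (`hasDegree_card`): an
ideal inside the kernels for finitely many points that contains, in large degrees, every form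
vanishing at them has degree the number of points. It applies to `I(X)` with all points, and to
`(I(X), f)` with the zeros of `f` in `X`. By `mem_zeroDivisorForms_iff`, `F_d` consists of the forms
vanishing at some but not all points. So both sides equal `|X|` minus the largest number of zeros of
such a form. -/

namespace ProjCode

open MvPolynomial

/-! ### Restriction to lines through the origin -/

section Line

variable {K : Type*} [Field K] {s : ℕ}

/-- Restriction of polynomials to the line through `v`, as the map `K[t_1, …, t_s] → K[T]`,
`t_i ↦ v_i T`. -/
noncomputable def restrictToLine (v : Fin s → K) : MvPolynomial (Fin s) K →ₐ[K] Polynomial K :=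
  aeval fun j => Polynomial.C (v j) * Polynomial.X

theorem restrictToLine_of_isHomogeneous (v : Fin s → K) {f : MvPolynomial (Fin s) K} {n : ℕ}
    (hf : f.IsHomogeneous n) :
    restrictToLine v f = Polynomial.C (eval v f) * Polynomial.X ^ n := by
  rw [restrictToLine, aeval_def, eval₂_eq', eval_eq', map_sum, Finset.sum_mul]
  refine Finset.sum_congr rfl fun m hm => ?_
  have hn : ∑ i, m i = n := by
    rw [hf.degree_eq_sum_deg_support hm, ← Finsupp.degree_apply, Finsupp.degree_eq_sum]
  simp only [mul_pow, Finset.prod_mul_distrib, Finset.prod_pow_eq_pow_sum, hn, map_mul, map_prod,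
    map_pow, Polynomial.algebraMap_eq, mul_assoc]

theorem restrictToLine_eq_zero_iff_of_isHomogeneous (v : Fin s → K)
    {f : MvPolynomial (Fin s) K} {n : ℕ} (hf : f.IsHomogeneous n) :
    restrictToLine v f = 0 ↔ eval v f = 0 := by
  simp [restrictToLine_of_isHomogeneous v hf]

theorem restrictToLine_surjective {v : Fin s → K} (hv : v ≠ 0) :
    Function.Surjective (restrictToLine v) := by
  obtain ⟨j, hj⟩ := Function.ne_iff.mp hv
  have hj : v j ≠ 0 := hj
  have hX : restrictToLine v (C (v j)⁻¹ * X j) = Polynomial.X := by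
    rw [restrictToLine_of_isHomogeneous v (isHomogeneous_C_mul_X _ _)]
    simp [hj]
  intro p
  refine ⟨Polynomial.aeval (C (v j)⁻¹ * X j) p, ?_⟩
  rw [← Polynomial.aeval_algHom_apply, hX, Polynomial.aeval_X_left_apply]

/-- The value of the `n`-th component at `v` is the coefficient of `T ^ n`. Working in `K[T]` rather
than with values on the line makes this valid over finite fields. -/
theorem eval_homogeneousComponent_eq_zero {v : Fin s → K} {f : MvPolynomial (Fin s) K}
    (hf : restrictToLine v f = 0) (n : ℕ) : eval v (homogeneousComponent n f) = 0 := by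
  by_cases hn : n ≤ f.totalDegree
  · have h := congrArg (fun p => Polynomial.coeff p n) hf
    rw [← sum_homogeneousComponent f, map_sum] at h
    simp only [restrictToLine_of_isHomogeneous v (homogeneousComponent_isHomogeneous _ f),
      Polynomial.finsetSum_coeff, Polynomial.coeff_C_mul_X_pow, Polynomial.coeff_zero] at h
    rw [Finset.sum_ite_eq] at h
    simpa [Nat.lt_succ_iff, hn] using h
  · rw [homogeneousComponent_eq_zero n f (by omega), map_zero]

theorem eval_smul_of_isHomogeneous {f : MvPolynomial (Fin s) K} {n : ℕ} (hf : f.IsHomogeneous n)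
    (a : K) (v : Fin s → K) : eval (a • v) f = a ^ n * eval v f := by
  have h := congrArg (Polynomial.aeval a) (restrictToLine_of_isHomogeneous v hf)
  rw [restrictToLine, ← AlgHom.comp_apply, comp_aeval] at h
  simp only [map_mul, Polynomial.aeval_C, Polynomial.aeval_X, map_pow, Algebra.algebraMap_self,
    RingHom.id_apply] at h
  rw [mul_comm, ← h, ← aeval_eq_eval]
  congr 2
  funext j
  simp [mul_comm]

end Line

/-! ### Interpolation by forms of large degree -/

section Interpolation

variable {K : Type*} [Field K] {s : ℕ}

theorem exists_linearForm_separating {v w : Fin s → K} (hv : v ≠ 0) (hw : w ≠ 0)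
    (h : Projectivization.mk K v hv ≠ Projectivization.mk K w hw) :
    ∃ l : MvPolynomial (Fin s) K, l.IsHomogeneous 1 ∧ eval v l ≠ 0 ∧ eval w l = 0 := by
  obtain ⟨j, hj⟩ := Function.ne_iff.mp hw
  have hj : w j ≠ 0 := hj
  by_contra! hcon
  apply h
  rw [Projectivization.mk_eq_mk_iff']
  refine ⟨v j / w j, funext fun i => ?_⟩
  by_contra hi
  -- If these forms, which vanish at `w`, all vanish at `v`, then `v = (v j / w j) • w`.
  refine hcon (C (w j) * X i - C (w i) * X j)
    ((isHomogeneous_C_mul_X _ _).sub (isHomogeneous_C_mul_X _ _)) (fun h0 => hi ?_) (by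
      simp [mul_comm])
  simp only [map_sub, map_mul, eval_C, eval_X] at h0
  simp only [Pi.smul_apply, smul_eq_mul]
  field_simp
  linear_combination -h0

variable {ι : Type*} [Fintype ι] {P : ι → Fin s → K}

/-- Multiply linear forms separating `P i` from the other points, pad with a coordinate nonzero at
`P i`, and normalize. -/
theorem exists_form_indicator (hP0 : ∀ i, P i ≠ 0)
    (hP : ∀ i j, i ≠ j → ∃ l : MvPolynomial (Fin s) K,
      l.IsHomogeneous 1 ∧ eval (P i) l ≠ 0 ∧ eval (P j) l = 0)
    {n : ℕ} (hn : Fintype.card ι ≤ n) (i : ι) :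
    ∃ h : MvPolynomial (Fin s) K, h.IsHomogeneous n ∧ eval (P i) h = 1 ∧
      ∀ j, j ≠ i → eval (P j) h = 0 := by
  classical
  obtain ⟨k, hk⟩ := Function.ne_iff.mp (hP0 i)
  have hk : P i k ≠ 0 := hk
  have hl : ∀ j, ∃ l : MvPolynomial (Fin s) K,
      l.IsHomogeneous 1 ∧ eval (P i) l ≠ 0 ∧ (j ≠ i → eval (P j) l = 0) := by
    intro j
    by_cases hj : j = i
    · exact ⟨X k, isHomogeneous_X _ _, by simpa using hk, fun h => absurd hj h⟩
    · obtain ⟨l, h1, h2, h3⟩ := hP i j (Ne.symm hj)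
      exact ⟨l, h1, h2, fun _ => h3⟩
  choose l hl1 hl2 hl3 using hl
  have hdeg : ((∏ j, l j) * X k ^ (n - Fintype.card ι)).IsHomogeneous n := by
    have := (IsHomogeneous.prod Finset.univ l (fun _ => 1) fun j _ => hl1 j).mul
      (isHomogeneous_X_pow k (n - Fintype.card ι))
    rwa [show ∑ _j : ι, 1 + (n - Fintype.card ι) = n by simp; omega] at this
  have hne : eval (P i) ((∏ j, l j) * X k ^ (n - Fintype.card ι)) ≠ 0 := by
    simp only [map_mul, map_prod, map_pow, eval_X]
    exact mul_ne_zero (Finset.prod_ne_zero_iff.mpr fun j _ => hl2 j) (pow_ne_zero _ hk)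
  refine ⟨C (eval (P i) ((∏ j, l j) * X k ^ (n - Fintype.card ι)))⁻¹ *
    ((∏ j, l j) * X k ^ (n - Fintype.card ι)), hdeg.C_mul _, ?_, fun j hj => ?_⟩
  · rw [map_mul, eval_C, inv_mul_cancel₀ hne]
  · have h0 : eval (P j) (∏ j, l j) = 0 := by
      rw [map_prod, Finset.prod_eq_zero (Finset.mem_univ j) (hl3 j hj)]
    rw [map_mul, map_mul (eval (P j)) (∏ j, l j), h0, zero_mul, mul_zero]

theorem exists_form_interpolating (hP0 : ∀ i, P i ≠ 0)
    (hP : ∀ i j, i ≠ j → ∃ l : MvPolynomial (Fin s) K,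
      l.IsHomogeneous 1 ∧ eval (P i) l ≠ 0 ∧ eval (P j) l = 0)
    {n : ℕ} (hn : Fintype.card ι ≤ n) (c : ι → K) :
    ∃ h : MvPolynomial (Fin s) K, h.IsHomogeneous n ∧ ∀ i, eval (P i) h = c i := by
  choose h h1 h2 h3 using exists_form_indicator hP0 hP hn
  refine ⟨∑ i, C (c i) * h i, IsHomogeneous.sum _ _ _ fun i _ => (h1 i).C_mul _, fun i => ?_⟩
  rw [map_sum, Finset.sum_eq_single i]
  · simp [h2]
  · intro j _ hj
    simp [h3 j i hj.symm]
  · simp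

end Interpolation

/-! ### Dimension and degree from finitely many points -/

section Degree

variable {K : Type*} [Field K] {s : ℕ} {ι : Type*} [Fintype ι] {P : ι → Fin s → K}
  {J : Ideal (MvPolynomial (Fin s) K)} {N : ℕ}

theorem hilbertFunction_eq_card (hP0 : ∀ i, P i ≠ 0)
    (hP : ∀ i j, i ≠ j → ∃ l : MvPolynomial (Fin s) K,
      l.IsHomogeneous 1 ∧ eval (P i) l ≠ 0 ∧ eval (P j) l = 0)
    {n : ℕ} (hn : Fintype.card ι ≤ n)
    (hJ : ∀ f : MvPolynomial (Fin s) K, f.IsHomogeneous n → (f ∈ J ↔ ∀ i, eval (P i) f = 0)) :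
    hilbertFunction J n = Fintype.card ι := by
  let φ : homogeneousSubmodule (Fin s) K n →ₗ[K] (ι → K) :=
    LinearMap.pi fun i => (aeval (P i)).toLinearMap ∘ₗ (homogeneousSubmodule (Fin s) K n).subtype
  have hφ : ∀ f i, φ f i = eval (P i) (f : MvPolynomial (Fin s) K) := fun f i => by
    simp [φ, aeval_eq_eval]
  have hker : (J.restrictScalars K).comap (homogeneousSubmodule (Fin s) K n).subtype =
      LinearMap.ker φ := by
    ext f
    rw [LinearMap.mem_ker, Submodule.mem_comap, Submodule.restrictScalars_mem, Submodule.subtype_apply,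
      hJ f f.2]
    simp [funext_iff, hφ]
  have hsurj : Function.Surjective φ := fun c => by
    obtain ⟨h, h1, h2⟩ := exists_form_interpolating hP0 hP hn c
    exact ⟨⟨h, h1⟩, funext fun i => by rw [hφ]; exact h2 i⟩
  rw [hilbertFunction, hker, (φ.quotKerEquivOfSurjective hsurj).finrank_eq, Module.finrank_pi]

/-- Otherwise each point has a form vanishing there and lying outside `Q`; a high power of their
product lies in `J ≤ Q`, contradicting primality. -/
theorem exists_ker_restrictToLine_le
    (hJ : ∀ n, N ≤ n → ∀ f : MvPolynomial (Fin s) K, f.IsHomogeneous n →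
      (∀ i, eval (P i) f = 0) → f ∈ J) [Nonempty ι]
    {Q : Ideal (MvPolynomial (Fin s) K)} [Q.IsPrime] (hQ : J ≤ Q) :
    ∃ i, RingHom.ker (restrictToLine (P i)) ≤ Q := by
  by_contra! hcon
  have H : ∀ i, ∃ (n : ℕ) (h : MvPolynomial (Fin s) K), 1 ≤ n ∧ h.IsHomogeneous n ∧
      eval (P i) h = 0 ∧ h ∉ Q := by
    intro i
    obtain ⟨f, hf, hfQ⟩ := SetLike.not_le_iff_exists.mp (hcon i)
    have hf : restrictToLine (P i) f = 0 := hf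
    have : ∃ n, homogeneousComponent n f ∉ Q := by
      by_contra! h
      exact hfQ (sum_homogeneousComponent f ▸ Q.sum_mem fun n _ => h n)
    obtain ⟨n, hn⟩ := this
    refine ⟨n, _, Nat.one_le_iff_ne_zero.mpr ?_, homogeneousComponent_isHomogeneous n f,
      eval_homogeneousComponent_eq_zero hf n, hn⟩
    rintro rfl
    have h0 := eval_homogeneousComponent_eq_zero hf 0
    rw [homogeneousComponent_zero, eval_C] at h0
    rw [homogeneousComponent_zero, h0, map_zero] at hn
    exact hn Q.zero_mem
  choose n h hn hh hev hQh using H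
  -- All `n i` are positive, so this power has degree at least `N`.
  have hmem : (∏ i, h i) ^ (N + 1) ∈ Q := by
    refine hQ (hJ ((∑ i, n i) * (N + 1)) ?_ _
      ((IsHomogeneous.prod _ _ _ fun i _ => hh i).pow _) fun i => ?_)
    · have : 1 ≤ ∑ i, n i :=
        (hn (Classical.arbitrary ι)).trans
          (Finset.single_le_sum (fun _ _ => Nat.zero_le _) (Finset.mem_univ _))
      nlinarith
    · rw [map_pow, map_prod, Finset.prod_eq_zero (Finset.mem_univ i) (hev i), zero_pow (by omega)]
  obtain ⟨i, -, hi⟩ := (Ideal.IsPrime.prod_mem_iff).mp (Ideal.IsPrime.mem_of_pow_mem ‹_› _ hmem)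
  exact hQh i hi

/-- The image of `Q` is a nonzero prime of the principal ideal domain `K[T]`. -/
theorem isMaximal_of_ker_restrictToLine_lt {v : Fin s → K} (hv : v ≠ 0)
    {Q : Ideal (MvPolynomial (Fin s) K)} [Q.IsPrime]
    (h : RingHom.ker (restrictToLine v) < Q) : Q.IsMaximal := by
  have hs := restrictToLine_surjective hv
  have hp : (Q.map (restrictToLine v)).IsPrime := Ideal.map_isPrime_of_surjective hs h.le
  have hc : (Q.map (restrictToLine v)).comap (restrictToLine v) = Q := by
    rw [Ideal.comap_map_of_surjective _ hs]
    exact sup_eq_left.mpr h.le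
  have hne : Q.map (restrictToLine v) ≠ ⊥ := fun h0 => by
    rw [h0] at hc
    exact h.ne hc
  have := IsPrime.to_maximal_ideal hne
  rw [← hc]
  exact Ideal.comap_isMaximal_of_surjective _ hs

theorem ringKrullDim_quotient_eq_one (hP0 : ∀ i, P i ≠ 0) [Nonempty ι]
    (hle : ∀ i, J ≤ RingHom.ker (restrictToLine (P i)))
    (hJ : ∀ n, N ≤ n → ∀ f : MvPolynomial (Fin s) K, f.IsHomogeneous n →
      (∀ i, eval (P i) f = 0) → f ∈ J) :
    ringKrullDim (MvPolynomial (Fin s) K ⧸ J) = 1 := by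
  refine le_antisymm ?_ ?_
  · have : Ring.KrullDimLE 1 (MvPolynomial (Fin s) K ⧸ J) := by
      rw [Ring.krullDimLE_one_iff]
      intro I hI
      -- A non-maximal prime is minimal: a strictly smaller prime would contain the kernel for some
      -- line, making the larger one maximal.
      refine or_iff_not_imp_right.mpr fun hmax => ⟨⟨hI, bot_le⟩, fun I' hI' hle' => ?_⟩
      by_contra hnot
      have := hI'.1
      have hlt : I'.comap (Ideal.Quotient.mk J) < I.comap (Ideal.Quotient.mk J) :=
        lt_of_le_not_ge (Ideal.comap_mono hle') fun h =>
          hnot ((Ideal.comap_le_comap_iff_of_surjective _ Ideal.Quotient.mk_surjective _ _).mp h)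
      have hJ' : J ≤ I'.comap (Ideal.Quotient.mk J) := fun x hx => by
        rw [Ideal.mem_comap, Ideal.Quotient.eq_zero_iff_mem.mpr hx]
        exact I'.zero_mem
      obtain ⟨i, hi⟩ := exists_ker_restrictToLine_le hJ hJ'
      have hm := isMaximal_of_ker_restrictToLine_lt (hP0 i) (hi.trans_lt hlt)
      apply hmax
      have h2 := Ideal.map_comap_of_surjective _ (Ideal.Quotient.mk_surjective (I := J)) I
      rcases Ideal.map_eq_top_or_isMaximal_of_surjective _
        (Ideal.Quotient.mk_surjective (I := J)) hm with h | h
      · exact absurd (h2.symm.trans h) hI.ne_top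
      · rwa [h2] at h
    exact_mod_cast Ring.krullDimLE_iff.mp this
  · let i := Classical.arbitrary ι
    let ψ := Ideal.Quotient.lift J (restrictToLine (P i)).toRingHom
      fun a ha => hle i ha
    have hψ : Function.Surjective ψ :=
      Ideal.Quotient.lift_surjective_of_surjective _ _ (restrictToLine_surjective (hP0 i))
    have h1 : ringKrullDim (Polynomial K) = 1 :=
      IsPrincipalIdealRing.ringKrullDim_eq_one _ (Polynomial.not_isField K)
    exact h1 ▸ ringKrullDim_le_of_surjective ψ hψ

theorem hasDegree_card (hP0 : ∀ i, P i ≠ 0)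
    (hP : ∀ i j, i ≠ j → ∃ l : MvPolynomial (Fin s) K,
      l.IsHomogeneous 1 ∧ eval (P i) l ≠ 0 ∧ eval (P j) l = 0) [Nonempty ι]
    (hle : ∀ i, J ≤ RingHom.ker (restrictToLine (P i)))
    (hJ : ∀ n, N ≤ n → ∀ f : MvPolynomial (Fin s) K, f.IsHomogeneous n →
      (∀ i, eval (P i) f = 0) → f ∈ J) :
    HasDegree J (Fintype.card ι) := by
  refine Or.inr ⟨0, by simpa using ringKrullDim_quotient_eq_one hP0 hle hJ, ?_⟩
  refine tendsto_const_nhds.congr' ?_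
  filter_upwards [eventually_ge_atTop (max N (Fintype.card ι))] with n hn
  have h : hilbertFunction J n = Fintype.card ι := by
    refine hilbertFunction_eq_card hP0 hP ((le_max_right _ _).trans hn) fun f hf => ⟨fun h i => ?_,
      hJ n ((le_max_left _ _).trans hn) f hf⟩
    exact (restrictToLine_eq_zero_iff_of_isHomogeneous _ hf).mp (hle i h)
  simp [h]

end Degree

/-! ### Zero divisors, zeros and weights -/

section Points

variable {K : Type*} [Field K] {s : ℕ} {ι : Type*} {P : ι → Fin s → K}
  {I : Ideal (MvPolynomial (Fin s) K)} {d : ℕ} {f : MvPolynomial (Fin s) K}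

theorem mem_vanishingIdeal_iff {X : Set (ℙ K (Fin s → K))} (hP0 : ∀ i, P i ≠ 0)
    (hX : X = Set.range fun i => Projectivization.mk K (P i) (hP0 i))
    {f : MvPolynomial (Fin s) K} :
    f ∈ vanishingIdeal X ↔ ∀ i, restrictToLine (P i) f = 0 := by
  constructor
  · intro hf i
    have h : vanishingIdeal X ≤ RingHom.ker (restrictToLine (P i)) := by
      rw [vanishingIdeal, Ideal.span_le]
      rintro f ⟨⟨n, hn⟩, hf⟩
      exact (restrictToLine_eq_zero_iff_of_isHomogeneous _ hn).mpr
        (hf (P i) (hP0 i) (hX ▸ ⟨i, rfl⟩))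
    exact h hf
  · intro hf
    rw [← sum_homogeneousComponent f]
    refine Ideal.sum_mem _ fun n _ => Ideal.subset_span
      ⟨⟨n, homogeneousComponent_isHomogeneous n f⟩, fun v hv hvX => ?_⟩
    rw [hX] at hvX
    obtain ⟨i, hi⟩ := hvX
    obtain ⟨a, ha⟩ := (Projectivization.mk_eq_mk_iff' K v (P i) hv (hP0 i)).mp hi.symm
    rw [← ha, eval_smul_of_isHomogeneous (homogeneousComponent_isHomogeneous n f),
      eval_homogeneousComponent_eq_zero (hf i), mul_zero]

theorem mem_iff_eval_of_isHomogeneous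
    (hI : ∀ f, f ∈ I ↔ ∀ i, restrictToLine (P i) f = 0) (hf : f.IsHomogeneous d) :
    f ∈ I ↔ ∀ i, eval (P i) f = 0 := by
  simp only [hI, restrictToLine_eq_zero_iff_of_isHomogeneous _ hf]

theorem evalMap_ne_zero_iff {g : ι → MvPolynomial (Fin s) K}
    (hg : ∀ i, eval (P i) (g i) ≠ 0) (f : homogeneousSubmodule (Fin s) K d) :
    evalMap d P g f ≠ 0 ↔ ∃ i, eval (P i) (f : MvPolynomial (Fin s) K) ≠ 0 := by
  rw [Function.ne_iff]
  simp [evalMap, hg]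

variable [Fintype ι]

/-- A form with no zero among the points is regular modulo `I`, since `K[T]` is a domain. Otherwise
a form equal to `1` at its zeros and `0` at the other points multiplies it into `I` without lying in
`I`. -/
theorem mem_zeroDivisorForms_iff (hP0 : ∀ i, P i ≠ 0)
    (hP : ∀ i j, i ≠ j → ∃ l : MvPolynomial (Fin s) K,
      l.IsHomogeneous 1 ∧ eval (P i) l ≠ 0 ∧ eval (P j) l = 0)
    (hI : ∀ f, f ∈ I ↔ ∀ i, restrictToLine (P i) f = 0) :
    f ∈ zeroDivisorForms I d ↔
      f.IsHomogeneous d ∧ (∃ i, eval (P i) f ≠ 0) ∧ ∃ i, eval (P i) f = 0 := by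
  classical
  refine and_congr_right fun hf => ?_
  refine and_congr ?_ ?_
  · rw [mem_iff_eval_of_isHomogeneous hI hf]
    push Not
    rfl
  · constructor
    · intro hne
      by_contra! hcon
      refine hne (le_antisymm (fun g hg => (hI g).mpr fun i => ?_) fun g hg => ?_)
      · have h := (hI _).mp (Submodule.mem_colon_singleton.mp hg) i
        rw [smul_eq_mul, map_mul] at h
        exact (mul_eq_zero.mp h).resolve_right fun h0 =>
          hcon i ((restrictToLine_eq_zero_iff_of_isHomogeneous _ hf).mp h0)
      · exact Submodule.mem_colon_singleton.mpr (I.mul_mem_right f hg)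
    · rintro ⟨i, hi⟩ heq
      obtain ⟨g, hg1, hg2⟩ := exists_form_interpolating hP0 hP le_rfl
        fun j => if eval (P j) f = 0 then (1 : K) else 0
      have hgI : g ∈ I := by
        rw [← heq, Submodule.mem_colon_singleton, smul_eq_mul,
          mem_iff_eval_of_isHomogeneous hI (hg1.mul hf)]
        intro j
        by_cases h : eval (P j) f = 0 <;> simp [hg2, h]
      have := (mem_iff_eval_of_isHomogeneous hI hg1).mp hgI i
      simp [hg2, hi] at this

theorem hasDegree_of_points [Nonempty ι] (hP0 : ∀ i, P i ≠ 0)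
    (hP : ∀ i j, i ≠ j → ∃ l : MvPolynomial (Fin s) K,
      l.IsHomogeneous 1 ∧ eval (P i) l ≠ 0 ∧ eval (P j) l = 0)
    (hI : ∀ f, f ∈ I ↔ ∀ i, restrictToLine (P i) f = 0) :
    HasDegree I (Fintype.card ι) :=
  hasDegree_card (N := 0) hP0 hP (fun i f hf => (hI f).mp hf i)
    fun _ _ _ hf => (mem_iff_eval_of_isHomogeneous hI hf).mpr

open Classical in
theorem hasDegree_sup_span_singleton (hP0 : ∀ i, P i ≠ 0)
    (hP : ∀ i j, i ≠ j → ∃ l : MvPolynomial (Fin s) K,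
      l.IsHomogeneous 1 ∧ eval (P i) l ≠ 0 ∧ eval (P j) l = 0)
    (hI : ∀ f, f ∈ I ↔ ∀ i, restrictToLine (P i) f = 0)
    (hf : f.IsHomogeneous d) (hf0 : ∃ i, eval (P i) f = 0) :
    HasDegree (I ⊔ Ideal.span {f}) (Fintype.card {i // eval (P i) f = 0}) := by
  obtain ⟨i, hi⟩ := hf0
  have : Nonempty {i // eval (P i) f = 0} := ⟨⟨i, hi⟩⟩
  -- This `N` leaves degree `n - d ≥ |ι|`, enough to interpolate `h / f` by a form `b`; then `h - b
  -- * f ∈ I`. At zeros of `f` the value of `b` is irrelevant, as `h` vanishes there too.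
  refine hasDegree_card (P := fun i : {i // eval (P i) f = 0} => P i) (N := d + Fintype.card ι)
    (fun i => hP0 i) (fun i j hij => hP i j fun h => hij (Subtype.ext h)) (fun j => ?_) ?_
  · refine sup_le (fun g hg => (hI g).mp hg j) ?_
    rw [Ideal.span_singleton_le_iff_mem]
    exact (restrictToLine_eq_zero_iff_of_isHomogeneous _ hf).mpr j.2
  · intro n hn h hh hv
    obtain ⟨b, hb1, hb2⟩ := exists_form_interpolating hP0 hP (n := n - d) (by omega)
      fun i => eval (P i) h / eval (P i) f
    have hbf : (b * f).IsHomogeneous n := by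
      have := hb1.mul hf
      rwa [Nat.sub_add_cancel (by omega)] at this
    have hmem : h - b * f ∈ I := by
      rw [mem_iff_eval_of_isHomogeneous hI (hh.sub hbf)]
      intro i
      by_cases h0 : eval (P i) f = 0
      · have h1 : eval (P i) h = 0 := hv ⟨i, h0⟩
        simp [h0, h1]
      · simp [hb2, h0]
    rw [← sub_add_cancel h (b * f)]
    exact add_mem (Ideal.mem_sup_left hmem)
      (Ideal.mem_sup_right (Ideal.mul_mem_left _ _ (Ideal.mem_span_singleton_self f)))

theorem zeroDivisorForms_nonempty [Nontrivial ι] (hd : 1 ≤ d) (hP0 : ∀ i, P i ≠ 0)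
    (hP : ∀ i j, i ≠ j → ∃ l : MvPolynomial (Fin s) K,
      l.IsHomogeneous 1 ∧ eval (P i) l ≠ 0 ∧ eval (P j) l = 0)
    (hI : ∀ f, f ∈ I ↔ ∀ i, restrictToLine (P i) f = 0) :
    (zeroDivisorForms I d).Nonempty := by
  obtain ⟨i, j, hij⟩ := exists_pair_ne ι
  obtain ⟨l, h1, h2, h3⟩ := hP i j hij
  refine ⟨l ^ d, (mem_zeroDivisorForms_iff hP0 hP hI).mpr
    ⟨by simpa using h1.pow d, ⟨i, by simp [h2]⟩, ⟨j, ?_⟩⟩⟩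
  rw [map_pow, h3, zero_pow (by omega)]

open Classical in
theorem hammingNorm_evalMap_add_card {g : ι → MvPolynomial (Fin s) K}
    (hg : ∀ i, eval (P i) (g i) ≠ 0) (f : homogeneousSubmodule (Fin s) K d) :
    hammingNorm (evalMap d P g f) +
      Fintype.card {i // eval (P i) (f : MvPolynomial (Fin s) K) = 0} = Fintype.card ι := by
  rw [hammingNorm, Fintype.card_subtype, add_comm, ← Finset.card_univ,
    ← Finset.card_filter_add_card_filter_not (s := Finset.univ)
      (fun i => eval (P i) (f : MvPolynomial (Fin s) K) = 0)]
  congr 3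
  ext i
  simp [evalMap, hg]

/-- The statement for an arbitrary ideal that consists of the polynomials vanishing on the lines
through finitely many points. -/
theorem minimumDistance_eq_minDistFunction [Nontrivial ι] (hd : 1 ≤ d) (hP0 : ∀ i, P i ≠ 0)
    (hP : ∀ i j, i ≠ j → ∃ l : MvPolynomial (Fin s) K,
      l.IsHomogeneous 1 ∧ eval (P i) l ≠ 0 ∧ eval (P j) l = 0)
    (hI : ∀ f, f ∈ I ↔ ∀ i, restrictToLine (P i) f = 0)
    {g : ι → MvPolynomial (Fin s) K} (hg : ∀ i, eval (P i) (g i) ≠ 0) :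
    IsGreatest (zeroDivisorDegrees I d) (sSup (zeroDivisorDegrees I d)) ∧
      (minimumDistance (reedMullerCode d P g) : ℤ) = minDistFunction I d ∧
      1 ≤ minDistFunction I d := by
  classical
  have hmem := fun f => mem_zeroDivisorForms_iff (d := d) (f := f) hP0 hP hI
  have hne := zeroDivisorForms_nonempty hd hP0 hP hI
  have hdeg : ∀ f ∈ zeroDivisorForms I d,
      degree (I ⊔ Ideal.span {f}) = Fintype.card {i // eval (P i) f = 0} := fun f hf =>
    (hasDegree_sup_span_singleton hP0 hP hI hf.1 ((hmem f).mp hf).2.2).degree_eq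
  have hlt : ∀ n ∈ zeroDivisorDegrees I d, n < Fintype.card ι := by
    rintro _ ⟨f, hf, rfl⟩
    obtain ⟨i, hi⟩ := ((hmem f).mp hf).2.1
    simp only [hdeg f hf]
    exact Fintype.card_subtype_lt hi
  have hbdd : BddAbove (zeroDivisorDegrees I d) := ⟨_, fun n hn => (hlt n hn).le⟩
  have hgr : IsGreatest (zeroDivisorDegrees I d) (sSup (zeroDivisorDegrees I d)) :=
    ⟨Nat.sSup_mem (hne.image _) hbdd, fun n hn => le_csSup hbdd hn⟩
  have hI' := (hasDegree_of_points hP0 hP hI).degree_eq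
  have hltS := hlt _ hgr.1
  refine ⟨hgr, ?_, ?_⟩
  · rw [minDistFunction, if_pos hne, hI', ← Nat.cast_sub hltS.le, Nat.cast_inj]
    refine IsLeast.csInf_eq ⟨?_, ?_⟩
    · obtain ⟨f, hf, hfS⟩ := hgr.1
      simp only [hdeg f hf] at hfS
      have h := hammingNorm_evalMap_add_card hg ⟨f, hf.1⟩
      refine ⟨_, ⟨⟨f, hf.1⟩, rfl⟩, (evalMap_ne_zero_iff hg _).mpr ((hmem f).mp hf).2.1, ?_⟩
      simp only at h
      omega
    · rintro n ⟨_, ⟨f, rfl⟩, hv, rfl⟩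
      have h := hammingNorm_evalMap_add_card hg f
      have hf1 := (evalMap_ne_zero_iff hg f).mp hv
      by_cases hf0 : ∃ i, eval (P i) (f : MvPolynomial (Fin s) K) = 0
      · have hf := (hmem f).mpr ⟨f.2, hf1, hf0⟩
        have := hgr.2 ⟨f, hf, hdeg f hf⟩
        omega
      -- Forms without zeros lie outside `F_d`, but their codewords have full weight `|ι|` and
      -- cannot lower the minimum.
      · have : Fintype.card {i // eval (P i) (f : MvPolynomial (Fin s) K) = 0} = 0 :=
          Fintype.card_eq_zero_iff.mpr ⟨fun i => hf0 ⟨i, i.2⟩⟩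
        omega
  · rw [minDistFunction, if_pos hne, hI']
    omega

end Points

end ProjCode

theorem theorem4p5 {K : Type*} [Field K] {s : ℕ} (X : Finset (ℙ K (Fin s → K)))
    (hX : 2 ≤ X.card) (d : ℕ) (hd : 1 ≤ d)
    (P : {x // x ∈ X} → Fin s → K)
    (hP : ∀ x, ∃ h : P x ≠ 0, Projectivization.mk K (P x) h = (x : ℙ K (Fin s → K)))
    (g : {x // x ∈ X} → MvPolynomial (Fin s) K)
    (hg : ∀ x, (g x).IsHomogeneous d)
    (hgP : ∀ x, MvPolynomial.eval (P x) (g x) ≠ 0) :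
    -- the degrees, and the maximum, in the definition of the minimum distance function exist
    HasDegree (vanishingIdeal (X : Set (ℙ K (Fin s → K))))
        (degree (vanishingIdeal (X : Set (ℙ K (Fin s → K))))) ∧
      (∀ f ∈ zeroDivisorForms (vanishingIdeal (X : Set (ℙ K (Fin s → K)))) d,
        HasDegree (vanishingIdeal (X : Set (ℙ K (Fin s → K))) ⊔ Ideal.span {f})
          (degree (vanishingIdeal (X : Set (ℙ K (Fin s → K))) ⊔ Ideal.span {f}))) ∧
      IsGreatest (zeroDivisorDegrees (vanishingIdeal (X : Set (ℙ K (Fin s → K)))) d)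
        (sSup (zeroDivisorDegrees (vanishingIdeal (X : Set (ℙ K (Fin s → K)))) d)) ∧
      -- the result
      (minimumDistance (reedMullerCode d P g) : ℤ) =
        minDistFunction (vanishingIdeal (X : Set (ℙ K (Fin s → K)))) d ∧
      1 ≤ minDistFunction (vanishingIdeal (X : Set (ℙ K (Fin s → K)))) d := by
  classical
  choose hP0 hPX using hP
  have hsep : ∀ i j, i ≠ j → ∃ l : MvPolynomial (Fin s) K,
      l.IsHomogeneous 1 ∧ MvPolynomial.eval (P i) l ≠ 0 ∧ MvPolynomial.eval (P j) l = 0 := by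
    intro i j hij
    refine exists_linearForm_separating (hP0 i) (hP0 j) fun h => hij (Subtype.ext ?_)
    rw [← hPX i, ← hPX j, h]
  have hI : ∀ f, f ∈ vanishingIdeal (X : Set (ℙ K (Fin s → K))) ↔
      ∀ i, restrictToLine (P i) f = 0 := fun f => by
    refine mem_vanishingIdeal_iff hP0 ?_
    simp only [hPX, Subtype.range_coe_subtype]
    rfl
  have : Nontrivial {x // x ∈ X} := by
    rw [← Fintype.one_lt_card_iff_nontrivial, Fintype.card_coe]
    omega
  have hIdeg := hasDegree_of_points hP0 hsep hI
  refine ⟨by rwa [hIdeg.degree_eq], fun f hf => ?_,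
    minimumDistance_eq_minDistFunction hd hP0 hsep hI hgP⟩
  have h := hasDegree_sup_span_singleton hP0 hsep hI hf.1
    ((mem_zeroDivisorForms_iff hP0 hsep hI).mp hf).2.2
  rwa [h.degree_eq]
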